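/- **Lemma.** Let $S^2\subset\mathbb{R}^3$ be the unit sphere with its surface measure and let $\Delta_{S^2}$ be the (negative-definite) Laplace–Beltrami operator, acting component-wise on $C^\infty(S^2;\mathbb{C}^3)$. Define operators $\mathfrak{M},\mathfrak{C}: C^\infty(S^2;\mathbb{C}^3)\to L^2(S^2;\mathbb{C}^3)$ by $$\mathfrak{M} = -\sum_{i,j,k,a,b=1}^3 \epsilon_{ijk}\,\epsilon_{iab}\, x_j\partial_k\, E_{a,b},\qquad \mathfrak{C} = -\Delta_{S^2}+2+2\mathfrak{M},$$ where $\epsilon_{ijk}$ is the Levi-Civita symbol and $E_{a,b}$ are the standard basis matrices of the $3\times 3$ matrices (the derivatives $\partial_k$ enter only through the combinations $x_j\partial_k-x_k\partial_j$, which are tangential to $S^2$). Then there are closed subspaces $W_{l,m}\subseteq L^2(S^2;\mathbb{C}^3)$, indexed by $(l,m)=(0,1)$ and by the pairs of integers $l\ge 1$, $m\ge 0$ with $|m-l|\le 1$, that are mutually orthogonal and satisfy $$L^2(S^2;\mathbb{C}^3) = W_{0,1}\oplus\bigoplus_{l\ge 1,\ |m-l|\le 1} W_{l,m}$$ (Hilbert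 space direct sum), such that every element of $W_{l,m}$ is (almost everywhere equal to) a smooth function, and every $\psi\in W_{l,m}\cap C^\infty(S^2;\mathbb{C}^3)$ satisfies $$\Delta_{S^2}\psi = -l(l+1)\,\psi,\qquad \mathfrak{C}\,\psi = m(m+1)\,\psi .$$ In other words, this decomposition diagonalises $\Delta_{S^2}$ and $\mathfrak{C}$ jointly. -/

import Mathlib

open MeasureTheory
open scoped Manifold ContDiff

/-- Euclidean space `ℝ³`. -/
abbrev RThree : Type := EuclideanSpace ℝ (Fin 3)

/-- The Hermitian space `ℂ³`. -/
abbrev CThree : Type := EuclideanSpace ℂ (Fin 3)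

/-- The unit sphere `S² ⊆ ℝ³`, with the manifold structure that Mathlib gives it. -/
abbrev SphereTwo : Type := Metric.sphere (0 : RThree) 1

instance finrankRThree : Fact (Module.finrank ℝ RThree = 2 + 1) := ⟨by simp⟩

/-- The surface measure of `S²` (of total mass `4π`). -/
noncomputable abbrev sphereMeasure : Measure SphereTwo := (volume : Measure RThree).toSphere

/-- The Hilbert space `L²(S²; ℂ³)`. -/
abbrev SphereL2 : Type := Lp CThree 2 sphereMeasure

/-- `ψ ∈ C^∞(S²; ℂ³)`. -/
def SmoothOnSphere (ψ : SphereTwo → CThree) : Prop :=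
  ContMDiff (𝓡 2) 𝓘(ℝ, CThree) ∞ ψ

open Classical in
/-- The extension of a function on `S²` that is constant along rays, `y ↦ f (y / |y|)`; the value
at the origin is irrelevant. -/
noncomputable def radialExtension {F : Type*} [Zero F] (f : SphereTwo → F) (y : RThree) : F :=
  if h : y ≠ 0 then f ⟨‖y‖⁻¹ • y, by simp [norm_smul, h]⟩ else 0

/-- The `k`-th component `∇ₖ f` of the surface gradient of `f` on `S²`: the derivative of `f` at `x`
in the direction of the orthogonal projection `eₖ - xₖ x` of `eₖ` to the tangent plane `Tₓ S²`.
(The extension of `f` is constant in the normal direction, so its derivative along `eₖ` is the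
derivative of `f` along this projection.) -/
noncomputable def sphereGrad {F : Type*} [NormedAddCommGroup F] [NormedSpace ℝ F]
    (k : Fin 3) (f : SphereTwo → F) (x : SphereTwo) : F :=
  fderiv ℝ (radialExtension f) (x : RThree) (EuclideanSpace.single k 1)

/-- The surface divergence `∑ₖ ∇ₖ Vₖ` of a vector field `V = (V₁, V₂, V₃)` on `S²`; for a tangential
field this is the Riemannian divergence. The components take values in `F`, so that the operator
acts separately on each component of an `F`-valued function. -/
noncomputable def sphereDiv {F : Type*} [NormedAddCommGroup F] [NormedSpace ℝ F]
    (V : Fin 3 → SphereTwo → F) (x : SphereTwo) : F :=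
  ∑ k, sphereGrad k (V k) x

/-- The (negative-definite) Laplace–Beltrami operator of `S²`, the divergence of the gradient,
acting component-wise on vector-valued functions. -/
noncomputable def sphereLaplacian {F : Type*} [NormedAddCommGroup F] [NormedSpace ℝ F]
    (f : SphereTwo → F) : SphereTwo → F :=
  sphereDiv (fun k => sphereGrad k f)

/-- The Levi-Civita symbol `ε_{ijk}`. -/
def leviCivita (i j k : Fin 3) : ℤ :=
  if (i, j, k) = (0, 1, 2) ∨ (i, j, k) = (1, 2, 0) ∨ (i, j, k) = (2, 0, 1) then 1
  else if (i, j, k) = (0, 2, 1) ∨ (i, j, k) = (2, 1, 0) ∨ (i, j, k) = (1, 0, 2) then -1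
  else 0

/-- The operator `𝔐 = - ∑ ε_{ijk} ε_{iab} x_j ∂_k E_{ab}`, where `E_{ab}` are the matrix units.
After summation over `j` and `k`, only the derivations `x_j ∂_k - x_k ∂_j` occur. They are tangential
to `S²`, so that `∂_k` may be replaced by `∇ₖ = ∂_k - x_k ∑ₗ x_l ∂_l`. -/
noncomputable def angularCoupling (ψ : SphereTwo → CThree) (x : SphereTwo) : CThree :=
  -∑ i, ∑ j, ∑ k, ∑ a, ∑ b,
    ((leviCivita i j k * leviCivita i a b : ℤ) : ℂ) • (((x : RThree) j : ℝ) : ℂ) •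
      Matrix.toEuclideanLin (Matrix.single a b (1 : ℂ)) (sphereGrad k ψ x)

/-- The Casimir operator `ℭ = -Δ_{S²} + 2 + 2 𝔐`. -/
noncomputable def sphereCasimir (ψ : SphereTwo → CThree) (x : SphereTwo) : CThree :=
  -sphereLaplacian ψ x + (2 : ℂ) • ψ x + (2 : ℂ) • angularCoupling ψ x

/-- The pairs `(l, m)` that occur: `(0, 1)`, and all `(l, m)` with `l ≥ 1` and `|m - l| ≤ 1`. -/
def IsMode (p : ℕ × ℕ) : Prop :=
  p = (0, 1) ∨ (1 ≤ p.1 ∧ |(p.2 : ℤ) - (p.1 : ℤ)| ≤ 1)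

/-!
The operators are those of the addition of angular momenta: with `T = x × ∇` the rotation fields,
`Δ_{S²} = ∑ Tᵢ²` and `𝔐 ψ = T × ψ` is the spin-orbit coupling `L · S` for spin one, so that `ℭ` is
the square of the total angular momentum. Everything is computed on polynomial vector fields, on
which these operators act algebraically (`sphereLaplacian_sphereEval`,
`angularCoupling_sphereEval`), and `W_{l,m}` is the space of restrictions to the sphere of the
polynomial fields of degree at most `l` that satisfy both eigenvalue equations on the sphere. It is
finite-dimensional, hence closed, and a smooth function that represents one of its elements
coincides with the polynomial everywhere.

*Orthogonality.* The surface measure is invariant under rotations, so `∫ Tᵢ f = 0`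
(`integral_rotDer`). Hence each `Tᵢ` is skew-symmetric, `Δ_{S²}` and `𝔐` are symmetric
(`inner_vecLap`, `inner_spinOrbit`), and eigenvectors for distinct eigenvalues are orthogonal.

*Completeness.* Polynomial fields are dense by Stone-Weierstrass. If `p` is homogeneous of degree
`n`, then `Δ_{S²} p = Δ p - n (n + 1) p` on the sphere, where `Δ p` has degree `n - 2`; by
induction on `n`, the restriction of `p` is a sum of eigenfields of `Δ_{S²}` with eigenvalues
`-l (l + 1)`, `l ≤ n` (`exists_harmonicPoly_sum`). The commutation relations of the `Tᵢ` give
`(𝔐² + 𝔐 + Δ_{S²}) (𝔐 + 1) = 0` (`spinOrbit_cubic`), which on the eigenspace of index `l` reads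
`(𝔐 - l) (𝔐 + l + 1) (𝔐 + 1) = 0`. For `l ≥ 1` the roots `l`, `-1`, `-l - 1` are distinct and the
eigenspace splits into the parts `m = l + 1`, `l`, `l - 1` (`harmonicPoly_le_modePoly`); for `l = 0`
the fields are constant, `𝔐 = 0`, and only `m = 1` occurs.
-/

open MvPolynomial

/-! ### Rotation fields acting on polynomials -/

/-- Complex polynomials in the three coordinates of `ℝ³`. -/
abbrev SpherePoly : Type := MvPolynomial (Fin 3) ℂ

/-- The rotation field `Tᵢ = x_{i+1} ∂_{i+2} - x_{i+2} ∂_{i+1}` about the `i`-th axis, indices being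
cyclic in `Fin 3`, as a derivation of the polynomial ring. -/
noncomputable def rotDer (i : Fin 3) : Derivation ℂ SpherePoly SpherePoly :=
  (X (i + 1) : SpherePoly) • pderiv (i + 2) - (X (i + 2) : SpherePoly) • pderiv (i + 1)

theorem rotDer_apply (i : Fin 3) (p : SpherePoly) :
    rotDer i p = X (i + 1) * pderiv (i + 2) p - X (i + 2) * pderiv (i + 1) p := by
  simp [rotDer]

theorem pderiv_pderiv_comm (i j : Fin 3) (p : SpherePoly) :
    pderiv i (pderiv j p) = pderiv j (pderiv i p) := by
  have h : ⁅(pderiv i : Derivation ℂ SpherePoly SpherePoly),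
      (pderiv j : Derivation ℂ SpherePoly SpherePoly)⁆ = 0 := by
    refine MvPolynomial.derivation_ext fun k => ?_
    simp only [Derivation.commutator_apply, pderiv_X, Pi.single_apply]
    split_ifs <;> simp
  have := congrArg (fun D => D p) h
  simpa [Derivation.commutator_apply, sub_eq_zero] using this

/-- The commutation relations `[Tᵢ, Tᵢ₊₁] = -Tᵢ₊₂` of the rotation Lie algebra. -/
theorem rotDer_comm (i : Fin 3) (p : SpherePoly) :
    rotDer i (rotDer (i + 1) p) = rotDer (i + 1) (rotDer i p) - rotDer (i + 2) p := by
  have h : ⁅rotDer i, rotDer (i + 1)⁆ = -rotDer (i + 2) := by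
    refine MvPolynomial.derivation_ext fun k => ?_
    rw [Derivation.commutator_apply]
    simp only [Derivation.coe_neg, Pi.neg_apply, rotDer_apply]
    fin_cases i <;> fin_cases k <;> simp [pderiv_X]
  have := congrArg (fun D => D p) h
  simp only [Derivation.commutator_apply, Derivation.coe_neg, Pi.neg_apply] at this
  linear_combination this

/-- The operator `∑ᵢ Tᵢ²` on polynomials. It restricts to the Laplacian of the sphere. -/
noncomputable def rotLap : SpherePoly →ₗ[ℂ] SpherePoly :=
  ∑ i, (rotDer i : SpherePoly →ₗ[ℂ] SpherePoly) ∘ₗ (rotDer i : SpherePoly →ₗ[ℂ] SpherePoly)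

theorem rotLap_apply (p : SpherePoly) : rotLap p = ∑ i, rotDer i (rotDer i p) := by
  simp [rotLap]

theorem rotLap_rotDer (i : Fin 3) (p : SpherePoly) : rotLap (rotDer i p) = rotDer i (rotLap p) := by
  have h0 := fun p => rotDer_comm 0 p
  have h1 := fun p => rotDer_comm 1 p
  have h2 := fun p => rotDer_comm 2 p
  simp only [Fin.isValue, Fin.reduceAdd, zero_add] at h0 h1 h2
  fin_cases i <;>
    simp [rotLap_apply, Fin.sum_univ_three, h0, h1, h2, map_add, map_sub] <;> ring

/-- Vector fields with values in `ℂ³` and polynomial components. -/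
abbrev SphereVecPoly : Type := Fin 3 → SpherePoly

/-- The operator `∑ᵢ Tᵢ²` acting on each component of a polynomial vector field. -/
noncomputable def vecLap : SphereVecPoly →ₗ[ℂ] SphereVecPoly := LinearMap.compLeft rotLap (Fin 3)

@[simp] theorem vecLap_apply (p : SphereVecPoly) (i : Fin 3) : vecLap p i = rotLap (p i) := rfl

/-- The spin-orbit coupling `p ↦ T × p` on polynomial vector fields. It restricts to `𝔐`. -/
noncomputable def spinOrbit : SphereVecPoly →ₗ[ℂ] SphereVecPoly :=
  LinearMap.pi fun i =>
    (rotDer (i + 1) : SpherePoly →ₗ[ℂ] SpherePoly) ∘ₗ LinearMap.proj (i + 2) -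
      (rotDer (i + 2) : SpherePoly →ₗ[ℂ] SpherePoly) ∘ₗ LinearMap.proj (i + 1)

theorem spinOrbit_apply (p : SphereVecPoly) (i : Fin 3) :
    spinOrbit p i = rotDer (i + 1) (p (i + 2)) - rotDer (i + 2) (p (i + 1)) := rfl

theorem vecLap_spinOrbit (p : SphereVecPoly) : vecLap (spinOrbit p) = spinOrbit (vecLap p) := by
  ext1 i
  simp [spinOrbit_apply, rotLap_rotDer]

/-- The identity `(𝔐² + 𝔐 + ∑ᵢ Tᵢ²) (𝔐 + 1) = 0`: the first factor is `q ↦ T (T · q)`, and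
`T · (T × p + p) = 0` by the commutation relations. -/
theorem spinOrbit_cubic (p : SphereVecPoly) :
    spinOrbit (spinOrbit (spinOrbit p + p)) + spinOrbit (spinOrbit p + p)
      + vecLap (spinOrbit p + p) = 0 := by
  have h0 := fun p => rotDer_comm 0 p
  have h1 := fun p => rotDer_comm 1 p
  -- Oriented this way, the three relations sort every product of rotations in descending order.
  have h2 := fun p => (sub_eq_iff_eq_add.mp (rotDer_comm 2 p).symm)
  simp only [Fin.isValue, Fin.reduceAdd, zero_add] at h0 h1 h2
  ext1 i
  fin_cases i <;>
    simp [spinOrbit_apply, rotLap_apply, Fin.sum_univ_three, h0, h1, h2, map_add, map_sub] <;>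
    ring

/-- The Laplacian of `ℝ³` on polynomials. -/
noncomputable def polyLaplacian (p : SpherePoly) : SpherePoly := ∑ i, pderiv i (pderiv i p)

/-- The Euler field `∑ᵢ xᵢ ∂ᵢ` on polynomials. -/
noncomputable def eulerDer (p : SpherePoly) : SpherePoly := ∑ i, X i * pderiv i p

/-- The polynomial `∂ₖ p - xₖ ∑ᵢ xᵢ ∂ᵢ p`, which restricts to the `k`-th component of the surface
gradient of `p`. -/
noncomputable def surfGrad (k : Fin 3) (p : SpherePoly) : SpherePoly :=
  pderiv k p - X k * eulerDer p

theorem rotLap_eq (p : SpherePoly) :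
    rotLap p = (∑ i, X i ^ 2) * polyLaplacian p - eulerDer (eulerDer p) - eulerDer p := by
  have h0 := pderiv_pderiv_comm 1 0 p
  have h1 := pderiv_pderiv_comm 2 0 p
  have h2 := pderiv_pderiv_comm 2 1 p
  simp [rotLap_apply, polyLaplacian, eulerDer, Fin.sum_univ_three, rotDer_apply, Derivation.leibniz,
    pderiv_X, h0, h1, h2]
  ring

/-- The divergence of the surface gradient agrees with `∑ᵢ Tᵢ²` up to a multiple of `1 - |x|²`. -/
theorem sum_surfGrad_surfGrad (p : SpherePoly) :
    ∑ k, surfGrad k (surfGrad k p) = rotLap p +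
      (1 - ∑ i, X i ^ 2) * (polyLaplacian p - eulerDer (eulerDer p) - eulerDer p) := by
  have h0 := pderiv_pderiv_comm 1 0 p
  have h1 := pderiv_pderiv_comm 2 0 p
  have h2 := pderiv_pderiv_comm 2 1 p
  rw [rotLap_eq]
  simp [polyLaplacian, surfGrad, eulerDer, Fin.sum_univ_three, Derivation.leibniz,
    pderiv_X, h0, h1, h2]
  ring

theorem MvPolynomial.IsHomogeneous.eulerDer_eq {p : SpherePoly} {n : ℕ} (hp : p.IsHomogeneous n) :
    eulerDer p = (n : ℂ) • p := by
  rw [eulerDer, hp.sum_X_mul_pderiv, Nat.cast_smul_eq_nsmul]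

theorem MvPolynomial.IsHomogeneous.rotLap_eq {p : SpherePoly} {n : ℕ} (hp : p.IsHomogeneous n) :
    rotLap p = (∑ i, X i ^ 2) * polyLaplacian p - ((n : ℂ) * (n + 1)) • p := by
  rw [_root_.rotLap_eq, hp.eulerDer_eq,
    ((homogeneousSubmodule (Fin 3) ℂ n).smul_mem (n : ℂ) hp : IsHomogeneous _ _).eulerDer_eq]
  module

theorem MvPolynomial.IsHomogeneous.polyLaplacian {p : SpherePoly} {n : ℕ}
    (hp : p.IsHomogeneous n) : (polyLaplacian p).IsHomogeneous (n - 2) := by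
  refine IsHomogeneous.sum _ _ _ fun i _ => ?_
  simpa [Nat.sub_sub] using hp.pderiv.pderiv

theorem MvPolynomial.IsHomogeneous.polyLaplacian_eq_zero {p : SpherePoly} {n : ℕ}
    (hp : p.IsHomogeneous n) (hn : n < 2) : _root_.polyLaplacian p = 0 := by
  refine Finset.sum_eq_zero fun i _ => ?_
  have h : (pderiv i p).IsHomogeneous 0 := by
    have := hp.pderiv (i := i)
    rwa [show n - 1 = 0 by omega] at this
  rw [totalDegree_eq_zero_iff_eq_C.mp (Nat.le_zero.mp h.totalDegree_le), pderiv_C]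

theorem MvPolynomial.IsHomogeneous.rotDer {p : SpherePoly} {n : ℕ} (hp : p.IsHomogeneous n)
    (i : Fin 3) : (rotDer i p).IsHomogeneous n := by
  rcases Nat.eq_zero_or_pos n with rfl | hn
  · rw [totalDegree_eq_zero_iff_eq_C.mp (Nat.le_zero.mp hp.totalDegree_le)]
    simpa [rotDer_apply] using isHomogeneous_zero _ _ _
  · rw [rotDer_apply]
    have h (j k : Fin 3) : (X j * pderiv k p : SpherePoly).IsHomogeneous n := by
      simpa [Nat.add_sub_cancel' hn] using (isHomogeneous_X ℂ j).mul hp.pderiv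
    exact (h _ _).sub (h _ _)

theorem totalDegree_rotDer_le (i : Fin 3) (p : SpherePoly) :
    (rotDer i p).totalDegree ≤ p.totalDegree := by
  conv_lhs => rw [← sum_homogeneousComponent p, map_sum]
  refine totalDegree_finsetSum_le fun n hn => ?_
  exact ((homogeneousComponent_isHomogeneous n p).rotDer i).totalDegree_le.trans
    (Nat.lt_succ_iff.mp (Finset.mem_range.mp hn))

/-- Polynomial vector fields whose components have total degree at most `n`. -/
noncomputable def vecDegreeLE (n : ℕ) : Submodule ℂ SphereVecPoly :=
  Submodule.pi Set.univ fun _ => restrictTotalDegree (Fin 3) ℂ n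

theorem mem_vecDegreeLE {n : ℕ} {p : SphereVecPoly} :
    p ∈ vecDegreeLE n ↔ ∀ i, (p i).totalDegree ≤ n := by
  simp [vecDegreeLE, mem_restrictTotalDegree]

theorem spinOrbit_mem_vecDegreeLE {n : ℕ} {p : SphereVecPoly} (hp : p ∈ vecDegreeLE n) :
    spinOrbit p ∈ vecDegreeLE n := by
  rw [mem_vecDegreeLE] at hp ⊢
  intro i
  rw [spinOrbit_apply]
  exact (totalDegree_sub _ _).trans (max_le ((totalDegree_rotDer_le _ _).trans (hp _))
    ((totalDegree_rotDer_le _ _).trans (hp _)))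

theorem vecDegreeLE_mono {m n : ℕ} (h : m ≤ n) : vecDegreeLE m ≤ vecDegreeLE n := fun p hp => by
  rw [mem_vecDegreeLE] at hp ⊢
  exact fun i => (hp i).trans h

instance (n : ℕ) : Module.Finite ℂ (vecDegreeLE n) :=
  Module.Finite.iff_fg.mpr (Submodule.fg_pi fun _ => Module.Finite.iff_fg.mp inferInstance)

/-! ### Polynomial fields restricted to the sphere -/

/-- Evaluation of a complex polynomial at a point of `ℝ³`. -/
noncomputable def realEval (x : RThree) : SpherePoly →ₐ[ℂ] ℂ :=
  MvPolynomial.aeval fun i => ((x i : ℝ) : ℂ)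

@[simp] theorem realEval_X (x : RThree) (i : Fin 3) : realEval x (X i) = ((x i : ℝ) : ℂ) := by
  simp [realEval]

theorem contDiff_realEval (p : SpherePoly) : ContDiff ℝ ∞ fun x => realEval x p := by
  induction p using MvPolynomial.induction_on with
  | C a => simpa [realEval] using contDiff_const
  | add p q hp hq => simpa using hp.add hq
  | mul_X p i hp =>
    simp only [map_mul, realEval_X]
    exact hp.mul (Complex.ofRealCLM.contDiff.comp (by fun_prop))

theorem hasFDerivAt_realEval (p : SpherePoly) (x : RThree) :
    HasFDerivAt (fun y => realEval y p)
      (∑ i, (Complex.ofRealCLM.comp (EuclideanSpace.proj i : RThree →L[ℝ] ℝ)).smulRight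
        (realEval x (pderiv i p))) x := by
  induction p using MvPolynomial.induction_on with
  | C a => simpa [realEval] using hasFDerivAt_const a x
  | add p q hp hq =>
    simp only [map_add]
    refine (hp.add hq).congr_fderiv ?_
    ext v
    simp [mul_add, Finset.sum_add_distrib]
  | mul_X p i hp =>
    simp only [map_mul, realEval_X]
    have h := (Complex.ofRealCLM.comp (EuclideanSpace.proj i : RThree →L[ℝ] ℝ)).hasFDerivAt (x := x)
    refine (hp.mul h).congr_fderiv ?_
    ext v
    simp [Derivation.leibniz, pderiv_X, Pi.single_apply, mul_add, Finset.sum_add_distrib,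
      Finset.mul_sum, apply_ite]
    rw [mul_comm]
    exact congrArg _ (Finset.sum_congr rfl fun j _ => by ring)

/-- The function `ℝ³ → ℂ³` defined by a polynomial vector field. -/
noncomputable def vecEval (p : SphereVecPoly) (x : RThree) : CThree :=
  WithLp.toLp 2 fun i => realEval x (p i)

@[simp] theorem vecEval_apply (p : SphereVecPoly) (x : RThree) (i : Fin 3) :
    vecEval p x i = realEval x (p i) := rfl

theorem contDiff_vecEval (p : SphereVecPoly) : ContDiff ℝ ∞ (vecEval p) :=
  (contDiff_piLp 2).mpr fun i => contDiff_realEval (p i)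

/-- The restriction of a polynomial vector field to the sphere. -/
noncomputable def sphereEval : SphereVecPoly →ₗ[ℂ] C(SphereTwo, CThree) where
  toFun p := ⟨fun x => vecEval p x, (contDiff_vecEval p).continuous.comp continuous_subtype_val⟩
  map_add' p q := by ext x i; simp
  map_smul' c p := by ext x i; simp

@[simp] theorem sphereEval_apply (p : SphereVecPoly) (x : SphereTwo) (i : Fin 3) :
    sphereEval p x i = realEval x (p i) := rfl

theorem smoothOnSphere_sphereEval (p : SphereVecPoly) : SmoothOnSphere (sphereEval p) :=
  (contDiff_vecEval p).contMDiff.comp contMDiff_coe_sphere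

/-- At a unit vector `x`, the derivative of `y ↦ y / |y|` is the orthogonal projection to `x^⊥`. -/
theorem hasFDerivAt_norm_inv_smul {x : RThree} (hx : ‖x‖ = 1) :
    HasFDerivAt (fun y : RThree => ‖y‖⁻¹ • y)
      (ContinuousLinearMap.id ℝ RThree - (innerSL ℝ x).smulRight x) x := by
  have h1 : HasFDerivAt (fun y : RThree => ‖y‖) (innerSL ℝ x) x := by
    have h := ((hasStrictFDerivAt_norm_sq x).hasFDerivAt.sqrt (by simp [hx]))
    simp only [Real.sqrt_sq (norm_nonneg _), hx] at h
    refine h.congr_fderiv ?_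
    ext v
    simp
  have h2 := (hasDerivAt_inv (x := ‖x‖) (by simp [hx])).comp_hasFDerivAt x h1
  refine (h2.smul (hasFDerivAt_id x)).congr_fderiv ?_
  ext v
  simp [hx]
  ring

theorem radialExtension_eventuallyEq (g : RThree → CThree) {x : RThree} (hx : x ≠ 0) :
    radialExtension (fun y : SphereTwo => g y) =ᶠ[nhds x] fun y => g (‖y‖⁻¹ • y) := by
  filter_upwards [isOpen_ne.mem_nhds hx] with y hy
  simp [radialExtension, (show y ≠ 0 from hy)]

theorem sphereGrad_sphereEval (k : Fin 3) (p : SphereVecPoly) (x : SphereTwo) :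
    sphereGrad k (sphereEval p) x = sphereEval (fun i => surfGrad k (p i)) x := by
  have hx : ‖(x : RThree)‖ = 1 := by simp
  have h0 : (x : RThree) ≠ 0 := by rintro h; simp [h] at hx
  have hd : HasFDerivAt (vecEval p) (fderiv ℝ (vecEval p) x) (‖(x : RThree)‖⁻¹ • (x : RThree)) := by
    rw [hx, inv_one, one_smul]
    exact ((contDiff_vecEval p).differentiable (by simp) x).hasFDerivAt
  have h := (HasFDerivAt.comp (f := fun y : RThree => ‖y‖⁻¹ • y) (x : RThree) hd
    (hasFDerivAt_norm_inv_smul hx)).congr_of_eventuallyEq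
    (radialExtension_eventuallyEq (vecEval p) h0)
  have h' : sphereGrad k (sphereEval p) x =
      fderiv ℝ (vecEval p) x (EuclideanSpace.single k 1 - (x : RThree) k • (x : RThree)) := by
    unfold sphereGrad
    -- `sphereEval p` unfolds to `vecEval p` on the sphere only by definition.
    erw [h.fderiv]
    simp [EuclideanSpace.inner_single_right]
  rw [h']
  ext i
  have hi := (hasFDerivAt_realEval (p i) x).unique
    (hasFDerivWithinAt_univ.mp ((hasFDerivWithinAt_piLp 2).mp
      ((contDiff_vecEval p).differentiable (by simp) x).hasFDerivAt.hasFDerivWithinAt i))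
  have hi' := congrArg (fun L => L (EuclideanSpace.single k 1 - (x : RThree) k • (x : RThree))) hi
  refine Eq.trans hi'.symm ?_
  fin_cases k <;> simp [surfGrad, eulerDer, Fin.sum_univ_three] <;> ring

theorem sphereGrad_sphereEval' (k : Fin 3) (p : SphereVecPoly) :
    sphereGrad k (sphereEval p) = sphereEval (fun i => surfGrad k (p i)) :=
  funext (sphereGrad_sphereEval k p)

theorem sum_sq_sphere (x : SphereTwo) : ∑ i, (((x : RThree) i : ℝ) : ℂ) ^ 2 = 1 := by
  have h : ‖(x : RThree)‖ ^ 2 = 1 := by simp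
  rw [EuclideanSpace.real_norm_sq_eq] at h
  exact_mod_cast h

theorem sphereLaplacian_sphereEval (p : SphereVecPoly) (x : SphereTwo) :
    sphereLaplacian (sphereEval p) x = sphereEval (vecLap p) x := by
  simp only [sphereLaplacian, sphereDiv, sphereGrad_sphereEval']
  ext i
  have h := congrArg (realEval x) (sum_surfGrad_surfGrad (p i))
  simp only [map_sum, map_add, map_mul, map_sub, map_one, map_pow, realEval_X, sum_sq_sphere,
    sub_self, zero_mul, add_zero] at h
  simpa using h

theorem angularCoupling_sphereEval (p : SphereVecPoly) (x : SphereTwo) :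
    angularCoupling (sphereEval p) x = sphereEval (spinOrbit p) x := by
  -- The matrix unit `E_{ab}` moves the component of index `b` to the place `a`.
  have hE (a b : Fin 3) (v : CThree) (c : Fin 3) :
      Matrix.toEuclideanLin (Matrix.single a b (1 : ℂ)) v c = if a = c then v b else 0 := by
    simp [Matrix.toLpLin_apply, Matrix.single_mulVec, Function.update_apply, eq_comm]
  ext c
  simp only [angularCoupling, sphereGrad_sphereEval', PiLp.neg_apply, WithLp.ofLp_sum,
    Finset.sum_apply, PiLp.smul_apply, hE, sphereEval_apply]
  clear hE
  simp only [Finset.sum_ite_irrel, smul_ite, smul_zero, Finset.sum_const_zero,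
    Finset.sum_ite_eq', Finset.mem_univ, if_true]
  fin_cases c <;>
    simp [Fin.sum_univ_three, leviCivita, spinOrbit_apply, rotDer_apply, surfGrad] <;> ring

theorem sphereCasimir_sphereEval (p : SphereVecPoly) (x : SphereTwo) :
    sphereCasimir (sphereEval p) x =
      sphereEval (-vecLap p + (2 : ℂ) • p + (2 : ℂ) • spinOrbit p) x := by
  rw [sphereCasimir, sphereLaplacian_sphereEval, angularCoupling_sphereEval]
  simp

/-- `𝔐` is well defined on restrictions: it maps fields vanishing on the sphere to such fields,
because `angularCoupling` depends only on the restriction. -/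
theorem sphereEval_spinOrbit_eq_zero {p : SphereVecPoly} (hp : sphereEval p = 0) :
    sphereEval (spinOrbit p) = 0 := by
  ext1 x
  rw [← angularCoupling_sphereEval, hp, ← map_zero sphereEval, angularCoupling_sphereEval, map_zero]

/-! ### Rotation invariance and symmetry in `L²` -/

/-- The rotation of `ℝ³` by the angle `t` about the `i`-th axis. -/
noncomputable def planeRotation (i : Fin 3) (t : ℝ) : RThree ≃ₗᵢ[ℝ] RThree :=
  LinearIsometry.toLinearIsometryEquiv
    { toFun := fun x => WithLp.toLp 2 fun j =>
        if j = i then x i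
        else if j = i + 1 then Real.cos t * x (i + 1) - Real.sin t * x (i + 2)
        else Real.sin t * x (i + 1) + Real.cos t * x (i + 2)
      map_add' := fun x y => by
        ext j
        simp only [PiLp.add_apply]
        split_ifs <;> ring
      map_smul' := fun c x => by
        ext j
        simp only [PiLp.smul_apply, smul_eq_mul, RingHom.id_apply]
        split_ifs <;> ring
      norm_map' := fun x => by
        rw [← sq_eq_sq₀ (norm_nonneg _) (norm_nonneg _), EuclideanSpace.real_norm_sq_eq,
          EuclideanSpace.real_norm_sq_eq]
        have h := Real.sin_sq_add_cos_sq t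
        fin_cases i <;> simp [Fin.sum_univ_three]
        · linear_combination (x 1 ^ 2 + x 2 ^ 2) * h
        · linear_combination (x 2 ^ 2 + x 0 ^ 2) * h
        · linear_combination (x 0 ^ 2 + x 1 ^ 2) * h } rfl

theorem planeRotation_apply (i : Fin 3) (t : ℝ) (x : RThree) (j : Fin 3) :
    planeRotation i t x j =
      if j = i then x i
      else if j = i + 1 then Real.cos t * x (i + 1) - Real.sin t * x (i + 2)
      else Real.sin t * x (i + 1) + Real.cos t * x (i + 2) := rfl

/-- The derivation `Tᵢ` generates the rotations about the `i`-th axis. -/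
theorem hasDerivAt_realEval_planeRotation (i : Fin 3) (p : SpherePoly) (x : RThree) (t : ℝ) :
    HasDerivAt (fun s => realEval (planeRotation i s x) p)
      (realEval (planeRotation i t x) (rotDer i p)) t := by
  induction p using MvPolynomial.induction_on with
  | C a => simpa [realEval, rotDer_apply] using hasDerivAt_const t a
  | add p q hp hq => simpa using! hp.add hq
  | mul_X p j hp =>
    have hX : HasDerivAt (fun s => realEval (planeRotation i s x) (X j))
        (realEval (planeRotation i t x) (rotDer i (X j))) t := by
      have hc := Real.hasDerivAt_cos t
      have hs := Real.hasDerivAt_sin t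
      have h1 := ((hc.mul_const (x (i + 1))).sub (hs.mul_const (x (i + 2)))).ofReal_comp
      have h2 := ((hs.mul_const (x (i + 1))).add (hc.mul_const (x (i + 2)))).ofReal_comp
      have h3 := hasDerivAt_const t ((x i : ℝ) : ℂ)
      simp only [realEval_X]
      fin_cases i <;> fin_cases j <;>
        simp [planeRotation_apply, rotDer_apply, pderiv_X] at h1 h2 h3 ⊢ <;>
        first
          | exact h3
          | (refine h1.congr_deriv ?_; ring)
          | (refine h2.congr_deriv ?_; ring)
    simp only [map_mul]
    refine (hp.mul hX).congr_deriv ?_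
    simp [Derivation.leibniz]
    ring

/-- The action of a linear isometry of `ℝ³` on the unit sphere. -/
noncomputable def sphereMap (e : RThree ≃ₗᵢ[ℝ] RThree) : C(SphereTwo, SphereTwo) where
  toFun x := ⟨e x, by simp⟩
  continuous_toFun := by fun_prop

open scoped Pointwise in
theorem measurePreserving_sphereMap (e : RThree ≃ₗᵢ[ℝ] RThree) :
    MeasurePreserving (sphereMap e) sphereMeasure sphereMeasure := by
  refine ⟨(sphereMap e).continuous.measurable, Measure.ext fun s hs => ?_⟩
  have hm := (sphereMap e).continuous.measurable hs
  rw [Measure.map_apply (sphereMap e).continuous.measurable hs, Measure.toSphere_apply' _ hs,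
    Measure.toSphere_apply' _ hm]
  congr 1
  rw [← (LinearIsometryEquiv.measurePreserving e).measure_preimage_emb
    e.toHomeomorph.measurableEmbedding (Set.Ioo (0 : ℝ) 1 • (Subtype.val '' s))]
  congr 1
  ext y
  simp only [Set.mem_smul, Set.mem_image, Set.mem_preimage]
  constructor
  · rintro ⟨r, hr, _, ⟨x, hx, rfl⟩, rfl⟩
    exact ⟨r, hr, _, ⟨_, hx, rfl⟩, by simp [sphereMap]⟩
  · rintro ⟨r, hr, _, ⟨x, hx, rfl⟩, h⟩
    refine ⟨r, hr, _, ⟨sphereMap e.symm x, ?_, rfl⟩, ?_⟩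
    · have : sphereMap e (sphereMap e.symm x) = x := by ext1; simp [sphereMap]
      simpa only [Set.mem_preimage, this] using hx
    · apply e.injective
      simpa [sphereMap] using h

theorem continuous_realEval_sphere (p : SpherePoly) :
    Continuous fun x : SphereTwo => realEval x p :=
  (contDiff_realEval p).continuous.comp continuous_subtype_val

theorem integrable_of_continuous_sphere {f : SphereTwo → ℂ} (hf : Continuous f) :
    Integrable f sphereMeasure :=
  hf.integrable_of_hasCompactSupport (HasCompactSupport.of_compactSpace f)

/-- Differentiating the constant function `t ↦ ∫ p (R_t x)` at `t = 0`, where `R_t` is the rotation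
about the `i`-th axis, shows that `Tᵢ p` has integral zero. -/
theorem integral_rotDer (i : Fin 3) (p : SpherePoly) :
    ∫ x : SphereTwo, realEval x (rotDer i p) ∂sphereMeasure = 0 := by
  have hcont (q : SpherePoly) (t : ℝ) :
      Continuous fun x : SphereTwo => realEval (planeRotation i t x) q :=
    (contDiff_realEval q).continuous.comp
      ((planeRotation i t).continuous.comp continuous_subtype_val)
  obtain ⟨C, hC⟩ := isCompact_univ.exists_bound_of_continuousOn
    (continuous_realEval_sphere (rotDer i p)).continuousOn
  have hbound : ∀ᵐ x : SphereTwo ∂sphereMeasure, ∀ t ∈ (Set.univ : Set ℝ),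
      ‖realEval (planeRotation i t x) (rotDer i p)‖ ≤ C :=
    .of_forall fun x t _ => hC (sphereMap (planeRotation i t) x) (Set.mem_univ _)
  have hdiff : ∀ᵐ x : SphereTwo ∂sphereMeasure, ∀ t ∈ (Set.univ : Set ℝ),
      HasDerivAt (fun s => realEval (planeRotation i s x) p)
        (realEval (planeRotation i t x) (rotDer i p)) t :=
    .of_forall fun x t _ => hasDerivAt_realEval_planeRotation i p x t
  have hmeas : ∀ᶠ t in nhds (0 : ℝ), AEStronglyMeasurable
      (fun x : SphereTwo => realEval (planeRotation i t x) p) sphereMeasure :=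
    .of_forall fun t => (hcont p t).aestronglyMeasurable
  have hderiv := (hasDerivAt_integral_of_dominated_loc_of_deriv_le Filter.univ_mem hmeas
    (integrable_of_continuous_sphere (hcont p 0)) (hcont _ 0).aestronglyMeasurable hbound
    (integrable_const C) hdiff).2
  have hconst (t : ℝ) : ∫ x : SphereTwo, realEval (planeRotation i t x) p ∂sphereMeasure =
      ∫ x : SphereTwo, realEval x p ∂sphereMeasure := by
    have h := measurePreserving_sphereMap (planeRotation i t)
    conv_rhs => rw [← h.map_eq, integral_map h.aemeasurable
      (continuous_realEval_sphere p).aestronglyMeasurable]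
    rfl
  simp only [hconst] at hderiv
  have h0 : planeRotation i 0 = LinearIsometryEquiv.refl ℝ RThree := by
    ext x j
    rw [planeRotation_apply]
    fin_cases i <;> fin_cases j <;> simp
  simpa [h0] using hderiv.unique (hasDerivAt_const (0 : ℝ) _)

/-- The polynomial with conjugate coefficients. -/
noncomputable def conjPoly : SpherePoly →+* SpherePoly := MvPolynomial.map (starRingEnd ℂ)

theorem realEval_conjPoly (x : RThree) (p : SpherePoly) :
    realEval x (conjPoly p) = starRingEnd ℂ (realEval x p) := by
  induction p using MvPolynomial.induction_on with
  | C a => simp [conjPoly, realEval]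
  | add p q hp hq => simp [hp, hq]
  | mul_X p i hp => simp [conjPoly] at hp ⊢; simp [hp]

theorem rotDer_conjPoly (i : Fin 3) (p : SpherePoly) :
    rotDer i (conjPoly p) = conjPoly (rotDer i p) := by
  simp [rotDer_apply, conjPoly, pderiv_map]

/-- The Hermitian pairing `∫ conj p * q` over the sphere, conjugate-linear in the first argument. -/
noncomputable def polyPairing (p q : SpherePoly) : ℂ :=
  ∫ x : SphereTwo, realEval x (conjPoly p * q) ∂sphereMeasure

theorem integral_realEval_add (p q : SpherePoly) :
    ∫ x : SphereTwo, realEval x (p + q) ∂sphereMeasure =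
      ∫ x : SphereTwo, realEval x p ∂sphereMeasure +
        ∫ x : SphereTwo, realEval x q ∂sphereMeasure := by
  simp only [map_add]
  exact integral_add (integrable_of_continuous_sphere (continuous_realEval_sphere p))
    (integrable_of_continuous_sphere (continuous_realEval_sphere q))

theorem polyPairing_add_right (p q r : SpherePoly) :
    polyPairing p (q + r) = polyPairing p q + polyPairing p r := by
  rw [polyPairing, mul_add, integral_realEval_add, polyPairing, polyPairing]

theorem polyPairing_add_left (p q r : SpherePoly) :
    polyPairing (p + q) r = polyPairing p r + polyPairing q r := by
  rw [polyPairing, map_add, add_mul, integral_realEval_add, polyPairing, polyPairing]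

theorem polyPairing_neg_right (p q : SpherePoly) : polyPairing p (-q) = -polyPairing p q := by
  simp [polyPairing, integral_neg]

theorem polyPairing_neg_left (p q : SpherePoly) : polyPairing (-p) q = -polyPairing p q := by
  simp [polyPairing, integral_neg]

theorem polyPairing_rotDer_left (i : Fin 3) (p q : SpherePoly) :
    polyPairing (rotDer i p) q = -polyPairing p (rotDer i q) := by
  rw [eq_neg_iff_add_eq_zero, polyPairing, polyPairing, ← integral_realEval_add,
    ← integral_rotDer i (conjPoly p * q), Derivation.leibniz, rotDer_conjPoly, smul_eq_mul,
    smul_eq_mul, mul_comm q, add_comm]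

/-- The class in `L²(S²; ℂ³)` of the restriction of a polynomial vector field to the sphere. -/
noncomputable def sphereToL2 : SphereVecPoly →ₗ[ℂ] SphereL2 :=
  (ContinuousMap.toLp 2 sphereMeasure ℂ : C(SphereTwo, CThree) →L[ℂ] SphereL2).toLinearMap ∘ₗ
    sphereEval

theorem sphereToL2_apply (p : SphereVecPoly) :
    sphereToL2 p = ContinuousMap.toLp 2 sphereMeasure ℂ (sphereEval p) := rfl

theorem coeFn_sphereToL2 (p : SphereVecPoly) : sphereToL2 p =ᵐ[sphereMeasure] sphereEval p :=
  ContinuousMap.coeFn_toLp sphereMeasure _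

theorem inner_sphereToL2 (p q : SphereVecPoly) :
    inner ℂ (sphereToL2 p) (sphereToL2 q) = ∑ i, polyPairing (p i) (q i) := by
  rw [L2.inner_def]
  simp only [polyPairing]
  rw [← integral_finsetSum _ fun i _ =>
    integrable_of_continuous_sphere (continuous_realEval_sphere _)]
  refine integral_congr_ae ?_
  filter_upwards [coeFn_sphereToL2 p, coeFn_sphereToL2 q] with x hp hq
  rw [hp, hq, PiLp.inner_apply]
  simp [realEval_conjPoly, mul_comm]

theorem inner_vecLap (p q : SphereVecPoly) :
    inner ℂ (sphereToL2 (vecLap p)) (sphereToL2 q) =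
      inner ℂ (sphereToL2 p) (sphereToL2 (vecLap q)) := by
  simp only [inner_sphereToL2, vecLap_apply, rotLap_apply, Fin.sum_univ_three,
    polyPairing_add_left, polyPairing_add_right, polyPairing_rotDer_left, neg_neg]

theorem inner_spinOrbit (p q : SphereVecPoly) :
    inner ℂ (sphereToL2 (spinOrbit p)) (sphereToL2 q) =
      inner ℂ (sphereToL2 p) (sphereToL2 (spinOrbit q)) := by
  simp only [inner_sphereToL2, spinOrbit_apply, Fin.sum_univ_three, sub_eq_add_neg,
    polyPairing_add_left, polyPairing_add_right, polyPairing_neg_left, polyPairing_neg_right,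
    polyPairing_rotDer_left, neg_neg, Fin.isValue, Fin.reduceAdd, zero_add]
  ring

/-! ### Density of polynomial fields -/

/-- The restriction of a polynomial to the sphere, as a homomorphism of algebras. -/
noncomputable def scalarEval : SpherePoly →ₐ[ℂ] C(SphereTwo, ℂ) where
  toFun p := ⟨fun x => realEval x p, continuous_realEval_sphere p⟩
  map_one' := by ext; simp
  map_mul' p q := by ext; simp
  map_zero' := by ext; simp
  map_add' p q := by ext; simp
  commutes' c := by ext; simp [realEval]

@[simp] theorem scalarEval_apply (p : SpherePoly) (x : SphereTwo) :
    scalarEval p x = realEval x p := rfl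

theorem denseRange_scalarEval : DenseRange scalarEval := by
  let A : StarSubalgebra ℂ C(SphereTwo, ℂ) :=
    { scalarEval.range with
      star_mem' := by
        rintro _ ⟨p, rfl⟩
        exact ⟨conjPoly p, by ext x; simp [realEval_conjPoly]⟩ }
  have hA : A.SeparatesPoints := by
    intro x y hxy
    obtain ⟨i, hi⟩ : ∃ i, (x : RThree) i ≠ (y : RThree) i := by
      by_contra! h
      exact hxy (Subtype.ext (PiLp.ext h))
    exact ⟨_, ⟨scalarEval (X i), ⟨X i, rfl⟩, rfl⟩, by simpa using hi⟩
  have h := ContinuousMap.starSubalgebra_topologicalClosure_eq_top_of_separatesPoints A hA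
  have h' : closure (A : Set C(SphereTwo, ℂ)) = Set.univ := by
    rw [← StarSubalgebra.topologicalClosure_coe, h]
    rfl
  exact dense_iff_closure_eq.mpr h'

/-- The inclusion of the scalar functions as the functions whose only nonzero component is the
`i`-th. -/
noncomputable def coordInclusion (i : Fin 3) : C(SphereTwo, ℂ) →L[ℂ] C(SphereTwo, CThree) :=
  ((ContinuousLinearMap.id ℂ ℂ).smulRight
    (EuclideanSpace.single i (1 : ℂ) : CThree)).compLeftContinuous ℂ SphereTwo

theorem sum_coordInclusion (f : C(SphereTwo, CThree)) :
    ∑ i, coordInclusion i ⟨fun x => f x i, by fun_prop⟩ = f := by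
  ext x j
  rw [ContinuousMap.sum_apply]
  fin_cases j <;> simp [coordInclusion, Fin.sum_univ_three]

theorem coordInclusion_scalarEval (i : Fin 3) (p : SpherePoly) :
    coordInclusion i (scalarEval p) = sphereEval (Pi.single i p) := by
  ext x j
  by_cases h : j = i
  · subst h; simp [coordInclusion]
  · simp [coordInclusion, h]

theorem topologicalClosure_range_sphereEval :
    (LinearMap.range sphereEval).topologicalClosure = ⊤ := by
  refine eq_top_iff.mpr fun f _ => ?_
  rw [← sum_coordInclusion f]
  refine Submodule.sum_mem _ fun i _ => ?_
  refine (coordInclusion i).continuous.range_subset_closure_image_dense denseRange_scalarEval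
    |>.trans (closure_mono ?_) (Set.mem_range_self _)
  rintro _ ⟨_, ⟨p, rfl⟩, rfl⟩
  exact ⟨Pi.single i p, (coordInclusion_scalarEval i p).symm⟩

theorem topologicalClosure_range_sphereToL2 :
    (LinearMap.range sphereToL2).topologicalClosure = ⊤ := by
  rw [sphereToL2, LinearMap.range_comp]
  exact (ContinuousMap.toLp_denseRange CThree sphereMeasure ℂ
    (p := 2) (by simp)).topologicalClosure_map_submodule topologicalClosure_range_sphereEval

/-! ### Joint eigenspaces -/

/-- Polynomial vector fields of degree at most `l` that satisfy `Δ_{S²} p = -l (l + 1) p` on the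
sphere. The equation is not imposed off the sphere, so `p` itself need not be harmonic. The bound on
the degree makes the space finite-dimensional. -/
noncomputable def harmonicPoly (l : ℕ) : Submodule ℂ SphereVecPoly :=
  vecDegreeLE l ⊓ LinearMap.ker
    (sphereEval ∘ₗ (vecLap + ((l : ℂ) * (l + 1)) • LinearMap.id))

theorem mem_harmonicPoly {l : ℕ} {p : SphereVecPoly} :
    p ∈ harmonicPoly l ↔
      p ∈ vecDegreeLE l ∧ sphereEval (vecLap p) + ((l : ℂ) * (l + 1)) • sphereEval p = 0 := by
  simp [harmonicPoly]

/-- The fields in `harmonicPoly l` that satisfy `ℭ p = m (m + 1) p` on the sphere. -/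
noncomputable def modePoly (l m : ℕ) : Submodule ℂ SphereVecPoly :=
  harmonicPoly l ⊓ LinearMap.ker (sphereEval ∘ₗ
    (-vecLap + (2 : ℂ) • LinearMap.id + (2 : ℂ) • spinOrbit - ((m : ℂ) * (m + 1)) • LinearMap.id))

theorem mem_modePoly {l m : ℕ} {p : SphereVecPoly} :
    p ∈ modePoly l m ↔ p ∈ harmonicPoly l ∧
      sphereEval (-vecLap p + (2 : ℂ) • p + (2 : ℂ) • spinOrbit p) =
        ((m : ℂ) * (m + 1)) • sphereEval p := by
  simp [modePoly, sub_eq_zero]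

/-- On the eigenspace of index `l`, an eigenvalue `a` of `𝔐` gives the eigenvalue
`l (l + 1) + 2 + 2 a` of `ℭ`. -/
theorem mem_modePoly_of_spinOrbit {l m : ℕ} {a : ℂ} {p : SphereVecPoly} (hp : p ∈ harmonicPoly l)
    (h : sphereEval (spinOrbit p) = a • sphereEval p)
    (ha : (m : ℂ) * (m + 1) = l * (l + 1) + 2 + 2 * a) : p ∈ modePoly l m := by
  refine mem_modePoly.mpr ⟨hp, ?_⟩
  have h2 := eq_neg_of_add_eq_zero_left (mem_harmonicPoly.mp hp).2
  simp only [map_add, map_neg, map_smul, h, h2, ha]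
  module

theorem spinOrbit_mem_harmonicPoly {l : ℕ} {p : SphereVecPoly} (hp : p ∈ harmonicPoly l) :
    spinOrbit p ∈ harmonicPoly l := by
  rw [mem_harmonicPoly] at hp ⊢
  refine ⟨spinOrbit_mem_vecDegreeLE hp.1, ?_⟩
  have h := sphereEval_spinOrbit_eq_zero (p := vecLap p + ((l : ℂ) * (l + 1)) • p)
    (by simpa using hp.2)
  simpa [vecLap_spinOrbit] using h

theorem sphereEval_spinOrbit_cubic {l : ℕ} {p : SphereVecPoly} (hp : p ∈ harmonicPoly l) :
    sphereEval (spinOrbit (spinOrbit (spinOrbit p)))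
      + (2 : ℂ) • sphereEval (spinOrbit (spinOrbit p))
      + (1 - (l : ℂ) * (l + 1)) • sphereEval (spinOrbit p) - ((l : ℂ) * (l + 1)) • sphereEval p
      = 0 := by
  have h := congrArg sphereEval (spinOrbit_cubic p)
  have h1 := (mem_harmonicPoly.mp hp).2
  have h2 := (mem_harmonicPoly.mp (spinOrbit_mem_harmonicPoly hp)).2
  simp only [map_add, map_zero] at h
  linear_combination (norm := module) h - h1 - h2

/-- For `l ≥ 1` the cubic equation of `𝔐` has the distinct roots `l`, `-1` and `-l - 1`, which
belong to `m = l + 1`, `m = l` and `m = l - 1`. -/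
theorem harmonicPoly_le_modePoly {l : ℕ} (hl : 1 ≤ l) :
    harmonicPoly l ≤ ⨆ m : {m : ℕ // IsMode (l, m)}, modePoly l m := by
  intro p hp
  have hM := spinOrbit_mem_harmonicPoly hp
  have hMM := spinOrbit_mem_harmonicPoly hM
  have hcub := sphereEval_spinOrbit_cubic hp
  have hl0 : (l : ℂ) ≠ 0 := by exact_mod_cast (by omega : l ≠ 0)
  have hl1 : (l : ℂ) + 1 ≠ 0 := by exact_mod_cast l.succ_ne_zero
  have hl2 : (l : ℂ) * 2 + 1 ≠ 0 := by exact_mod_cast (by omega : l * 2 + 1 ≠ 0)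
  -- For roots `b`, `c` the product `(𝔐 - b) (𝔐 - c)` projects, up to a scalar, to the eigenspace of
  -- the third root.
  have key (b c : ℂ) : spinOrbit (spinOrbit p) - (b + c) • spinOrbit p + (b * c) • p
      ∈ harmonicPoly l :=
    Submodule.add_mem _ (Submodule.sub_mem _ hMM (Submodule.smul_mem _ _ hM))
      (Submodule.smul_mem _ _ hp)
  have h1 : spinOrbit (spinOrbit p) - (-1 + (-l - 1) : ℂ) • spinOrbit p + (-1 * (-l - 1) : ℂ) • p
      ∈ modePoly l (l + 1) := by
    refine mem_modePoly_of_spinOrbit (a := l) (key _ _) ?_ (by push_cast; ring)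
    simp only [map_add, map_sub, map_smul]
    linear_combination (norm := module) hcub
  have h2 : spinOrbit (spinOrbit p) - (l + (-l - 1) : ℂ) • spinOrbit p + (l * (-l - 1) : ℂ) • p
      ∈ modePoly l l := by
    refine mem_modePoly_of_spinOrbit (a := -1) (key _ _) ?_ (by ring)
    simp only [map_add, map_sub, map_smul]
    linear_combination (norm := module) hcub
  have h3 : spinOrbit (spinOrbit p) - (l + -1 : ℂ) • spinOrbit p + (l * -1 : ℂ) • p
      ∈ modePoly l (l - 1) := by
    refine mem_modePoly_of_spinOrbit (a := -l - 1) (key _ _) ?_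
      (by push_cast [Nat.cast_sub hl]; ring)
    simp only [map_add, map_sub, map_smul]
    linear_combination (norm := module) hcub
  have hsup (m : ℕ) (hm : IsMode (l, m)) :
      modePoly l m ≤ ⨆ m : {m : ℕ // IsMode (l, m)}, modePoly l m :=
    le_iSup (fun m : {m : ℕ // IsMode (l, m)} => modePoly l m) ⟨m, hm⟩
  have h1' := hsup _ (Or.inr ⟨hl, by simp⟩) h1
  have h2' := hsup _ (Or.inr ⟨hl, by simp⟩) h2
  have h3' := hsup _ (Or.inr ⟨hl, by simp [Nat.cast_sub hl]⟩) h3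
  -- Lagrange interpolation at the three roots writes `p` as a sum of its projections.
  have := Submodule.add_mem _ (Submodule.add_mem _
    (Submodule.smul_mem _ (((l : ℂ) + 1) * (l * 2 + 1))⁻¹ h1')
    (Submodule.smul_mem _ (-((l : ℂ) * (l + 1))⁻¹) h2'))
    (Submodule.smul_mem _ ((l : ℂ) * (l * 2 + 1))⁻¹ h3')
  convert this using 1
  match_scalars <;> field_simp <;> ring

theorem harmonicPoly_zero_le : harmonicPoly 0 ≤ modePoly 0 1 := by
  intro p hp
  refine mem_modePoly_of_spinOrbit (a := 0) hp ?_ (by norm_num)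
  have h0 (i : Fin 3) : p i = C ((p i).coeff 0) :=
    totalDegree_eq_zero_iff_eq_C.mp (Nat.le_zero.mp
      (mem_vecDegreeLE.mp (mem_harmonicPoly.mp hp).1 i))
  have : spinOrbit p = 0 := by
    ext1 i
    rw [spinOrbit_apply, h0 (i + 1), h0 (i + 2)]
    simp
  rw [this, map_zero]
  exact (zero_smul ℂ (sphereEval p)).symm

/-- On the sphere, a homogeneous field of degree `n` is a sum of eigenfields of the Laplacian of
indices `l ≤ n`. -/
theorem exists_harmonicPoly_sum (n : ℕ) (p : SphereVecPoly) (hp : ∀ i, (p i).IsHomogeneous n) :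
    ∃ q : ℕ → SphereVecPoly, (∀ l, q l ∈ harmonicPoly l) ∧
      sphereEval p = ∑ l ∈ Finset.range (n + 1), sphereEval (q l) := by
  induction n using Nat.strong_induction_on generalizing p with
  | _ n ih =>
    obtain ⟨q, hq, hqs⟩ : ∃ q : ℕ → SphereVecPoly, (∀ l, q l ∈ harmonicPoly l) ∧
        sphereEval (fun i => polyLaplacian (p i)) = ∑ l ∈ Finset.range n, sphereEval (q l) := by
      rcases lt_or_ge n 2 with hn | hn
      · refine ⟨0, fun l => Submodule.zero_mem _, ?_⟩
        have : (fun i => polyLaplacian (p i)) = 0 :=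
          funext fun i => (hp i).polyLaplacian_eq_zero hn
        simp [this]
      · obtain ⟨k, rfl⟩ := Nat.exists_eq_add_of_le' hn
        obtain ⟨q, hq, h⟩ := ih k (by omega) _ fun i => (hp i).polyLaplacian
        refine ⟨Function.update q (k + 1) 0, fun l => ?_, ?_⟩
        · rcases eq_or_ne l (k + 1) with rfl | hl
          · simp
          · simpa [hl] using hq l
        · rw [h, Finset.sum_range_succ _ (k + 1), Function.update_self, map_zero, add_zero]
          exact Finset.sum_congr rfl fun l hl => by
            rw [Function.update_of_ne (Finset.mem_range.mp hl).ne]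
    have hlap : sphereEval (vecLap p) =
        sphereEval (fun i => polyLaplacian (p i)) - ((n : ℂ) * (n + 1)) • sphereEval p := by
      ext x i
      have h := congrArg (realEval x) (hp i).rotLap_eq
      simpa [sum_sq_sphere] using h
    -- The coefficients for which `p - ∑ c_l q_l` is an eigenfield of index `n`.
    let c (l : ℕ) : ℂ := ((n : ℂ) * (n + 1) - l * (l + 1))⁻¹
    have hc (l : ℕ) (hl : l < n) : c l * ((n : ℂ) * (n + 1) - l * (l + 1)) = 1 := by
      refine inv_mul_cancel₀ (sub_ne_zero.mpr ?_)
      exact_mod_cast (by nlinarith : l * (l + 1) < n * (n + 1)).ne'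
    have htop : p - ∑ l ∈ Finset.range n, c l • q l ∈ harmonicPoly n := by
      refine mem_harmonicPoly.mpr ⟨?_, ?_⟩
      · refine Submodule.sub_mem _ (mem_vecDegreeLE.mpr fun i => (hp i).totalDegree_le) ?_
        refine Submodule.sum_mem _ fun l hl => Submodule.smul_mem _ _ ?_
        exact vecDegreeLE_mono (Finset.mem_range.mp hl).le (mem_harmonicPoly.mp (hq l)).1
      · have hsum : ∑ l ∈ Finset.range n, sphereEval (q l) =
            ((n : ℂ) * (n + 1)) • ∑ l ∈ Finset.range n, c l • sphereEval (q l) +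
              ∑ l ∈ Finset.range n, c l • sphereEval (vecLap (q l)) := by
          rw [Finset.smul_sum, ← Finset.sum_add_distrib]
          refine Finset.sum_congr rfl fun l hl => ?_
          rw [eq_neg_of_add_eq_zero_left (mem_harmonicPoly.mp (hq l)).2]
          linear_combination (norm := module) (-(hc l (Finset.mem_range.mp hl))) • sphereEval (q l)
        simp only [map_sub, map_sum, map_smul, hlap, hqs, hsum]
        module
    refine ⟨Function.update (fun l => c l • q l) n (p - ∑ l ∈ Finset.range n, c l • q l),
      fun l => ?_, ?_⟩
    · rcases eq_or_ne l n with rfl | hl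
      · simpa using htop
      · simpa [hl] using Submodule.smul_mem _ (c l) (hq l)
    · rw [Finset.sum_range_succ, Function.update_self, map_sub, map_sum,
        Finset.sum_congr rfl fun l hl => by
          rw [Function.update_of_ne (Finset.mem_range.mp hl).ne]]
      abel

/-- The space `W_{l,m}`. -/
noncomputable def modeSpace (p : {p : ℕ × ℕ // IsMode p}) : Submodule ℂ SphereL2 :=
  (modePoly p.1.1 p.1.2).map sphereToL2

theorem sphereToL2_harmonicPoly_mem {l : ℕ} {p : SphereVecPoly} (hp : p ∈ harmonicPoly l) :
    sphereToL2 p ∈ ⨆ i, modeSpace i := by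
  suffices h : harmonicPoly l ≤ (⨆ i, modeSpace i).comap sphereToL2 from h hp
  have hmode (m : ℕ) (hm : IsMode (l, m)) :
      modePoly l m ≤ (⨆ i, modeSpace i).comap sphereToL2 :=
    Submodule.map_le_iff_le_comap.mp (le_iSup modeSpace ⟨(l, m), hm⟩)
  rcases Nat.eq_zero_or_pos l with rfl | hl
  · exact harmonicPoly_zero_le.trans (hmode 1 (Or.inl rfl))
  · exact (harmonicPoly_le_modePoly hl).trans (iSup_le fun m => hmode m m.2)

theorem range_sphereToL2_le : LinearMap.range sphereToL2 ≤ ⨆ i, modeSpace i := by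
  rintro _ ⟨p, rfl⟩
  have hhom (n : ℕ) (p : SphereVecPoly) (hp : ∀ i, (p i).IsHomogeneous n) :
      sphereToL2 p ∈ ⨆ i, modeSpace i := by
    obtain ⟨q, hq, h⟩ := exists_harmonicPoly_sum n p hp
    rw [sphereToL2_apply, h, map_sum]
    exact Submodule.sum_mem _ fun l _ => sphereToL2_harmonicPoly_mem (hq l)
  -- Fields with a single nonzero component, which is homogeneous, span.
  have hp : p = ∑ j, ∑ n ∈ Finset.range ((p j).totalDegree + 1),
      Pi.single j (homogeneousComponent n (p j)) := by
    ext1 i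
    simp only [Finset.sum_apply, Pi.single_apply, Finset.sum_ite_irrel, Finset.sum_const_zero,
      Finset.sum_ite_eq, Finset.mem_univ, if_true, sum_homogeneousComponent]
  rw [hp]
  simp only [map_sum]
  refine Submodule.sum_mem _ fun j _ => Submodule.sum_mem _ fun n _ => hhom n _ fun i => ?_
  rcases eq_or_ne i j with rfl | hij
  · simpa using homogeneousComponent_isHomogeneous n (p i)
  · simpa [hij] using isHomogeneous_zero _ _ _

theorem eq_zero_of_symmetric_eigen {E : Type*} [NormedAddCommGroup E] [InnerProductSpace ℂ E]
    {u v u' v' : E} {a b : ℝ} (hab : a ≠ b) (hu : u' = (a : ℂ) • u) (hv : v' = (b : ℂ) • v)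
    (h : inner ℂ u' v = inner ℂ u v') : inner ℂ u v = (0 : ℂ) := by
  rw [hu, hv, inner_smul_left, inner_smul_right, Complex.conj_ofReal] at h
  have : ((a : ℂ) - b) * inner ℂ u v = 0 := by linear_combination h
  exact (mul_eq_zero.mp this).resolve_left (sub_ne_zero.mpr (by exact_mod_cast hab))

theorem natCast_mul_succ_injective : Function.Injective fun n : ℕ => (n : ℝ) * (n + 1) := by
  refine StrictMono.injective (strictMono_nat_of_lt_succ fun n => ?_)
  push_cast
  nlinarith [(n.cast_nonneg : (0 : ℝ) ≤ n)]

theorem orthogonalFamily_modeSpace :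
    OrthogonalFamily ℂ (fun i => modeSpace i) fun i => (modeSpace i).subtypeₗᵢ := by
  rintro ⟨⟨l, m⟩, hlm⟩ ⟨⟨l', m'⟩, hlm'⟩ hne ⟨_, p, hp, rfl⟩ ⟨_, q, hq, rfl⟩
  change inner ℂ (sphereToL2 p) (sphereToL2 q) = 0
  have hp2 := mem_modePoly.mp hp
  have hq2 := mem_modePoly.mp hq
  have hlap {l : ℕ} {p : SphereVecPoly} (hp : p ∈ harmonicPoly l) :
      sphereToL2 (vecLap p) = ((-((l : ℝ) * (l + 1)) : ℝ) : ℂ) • sphereToL2 p := by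
    rw [sphereToL2_apply, eq_neg_of_add_eq_zero_left (mem_harmonicPoly.mp hp).2, sphereToL2_apply]
    push_cast
    simp
  by_cases hl : l = l'
  · have hm : m ≠ m' := by
      rintro rfl
      subst hl
      exact hne rfl
    refine eq_zero_of_symmetric_eigen (u' := sphereToL2 (-vecLap p + (2 : ℂ) • p +
      (2 : ℂ) • spinOrbit p)) (v' := sphereToL2 (-vecLap q + (2 : ℂ) • q + (2 : ℂ) • spinOrbit q))
      (natCast_mul_succ_injective.ne hm) ?_ ?_ ?_
    · rw [sphereToL2_apply, hp2.2, sphereToL2_apply]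
      push_cast
      simp
    · rw [sphereToL2_apply, hq2.2, sphereToL2_apply]
      push_cast
      simp
    · simp only [map_add, map_neg, map_smul, inner_add_left, inner_add_right, inner_neg_left,
        inner_neg_right, inner_smul_left, inner_smul_right, inner_vecLap, inner_spinOrbit,
        Complex.conj_ofNat]
  · exact eq_zero_of_symmetric_eigen (neg_injective.ne (natCast_mul_succ_injective.ne hl))
      (hlap hp2.1) (hlap hq2.1) (inner_vecLap p q)

instance modePoly_finite (l m : ℕ) : Module.Finite ℂ (modePoly l m) :=
  Submodule.finiteDimensional_of_le (inf_le_left.trans inf_le_left : modePoly l m ≤ vecDegreeLE l)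

instance (i : {p : ℕ × ℕ // IsMode p}) : FiniteDimensional ℂ (modeSpace i) :=
  inferInstanceAs (FiniteDimensional ℂ ((modePoly i.1.1 i.1.2).map sphereToL2))

theorem mainTheorem5 :
    ∃ W : {p : ℕ × ℕ // IsMode p} → Submodule ℂ SphereL2,
      -- the `W_{l,m}` are closed, mutually orthogonal, and `L²(S²; ℂ³)` is their Hilbert sum
      (∀ p, IsClosed (W p : Set SphereL2)) ∧
      IsHilbertSum ℂ (fun p => W p) (fun p => (W p).subtypeₗᵢ) ∧
      -- every element of `W_{l,m}` is (almost everywhere equal to) a smooth function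
      (∀ p, ∀ w ∈ W p, ∃ ψ : SphereTwo → CThree, SmoothOnSphere ψ ∧ w =ᵐ[sphereMeasure] ψ) ∧
      -- the smooth functions in `W_{l,m}` are eigenfunctions of both operators
      (∀ p, ∀ w ∈ W p, ∀ ψ : SphereTwo → CThree, SmoothOnSphere ψ → w =ᵐ[sphereMeasure] ψ →
        (∀ x, sphereLaplacian ψ x = (-((p.1.1 : ℂ) * ((p.1.1 : ℂ) + 1))) • ψ x) ∧
        (∀ x, sphereCasimir ψ x = ((p.1.2 : ℂ) * ((p.1.2 : ℂ) + 1)) • ψ x)) := by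
  refine ⟨modeSpace, fun i => (modeSpace i).closed_of_finiteDimensional,
    IsHilbertSum.mkInternal _ orthogonalFamily_modeSpace ?_, ?_, ?_⟩
  · rw [← topologicalClosure_range_sphereToL2]
    exact Submodule.topologicalClosure_mono range_sphereToL2_le
  · rintro i _ ⟨p, -, rfl⟩
    exact ⟨_, smoothOnSphere_sphereEval p, coeFn_sphereToL2 p⟩
  · rintro i _ ⟨p, hp, rfl⟩ ψ hψ hpψ
    -- Continuous functions that agree almost everywhere agree, as the surface measure charges every
    -- nonempty open set.
    obtain rfl : sphereEval p = ψ :=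
      ((map_continuous _).ae_eq_iff_eq sphereMeasure hψ.continuous).mp
        ((coeFn_sphereToL2 p).symm.trans hpψ)
    obtain ⟨hharm, hcas⟩ := mem_modePoly.mp hp
    refine ⟨fun x => ?_, fun x => ?_⟩
    · rw [sphereLaplacian_sphereEval, eq_neg_of_add_eq_zero_left (mem_harmonicPoly.mp hharm).2]
      simp
    · rw [sphereCasimir_sphereEval, hcas]
      rfl
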